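/- Let $n \ge 4$, $m \ge n+2$ and $p \ge m/2$ be integers. Let $f_1,\dots,f_m:\mathbb{R}^n\to\mathbb{R}$ be non-zero linear functionals whose only common zero is $0$, so that $$\|x\| = \Big(\sum_{i=1}^m |f_i(x)|^{2p}\Big)^{\frac1{2p}}$$ is a norm on $\mathbb{R}^n$, and let $X=(\mathbb{R}^n,\|\cdot\|)$. Let $0<\alpha\le\frac12$ be a real number such that for all $1\le j<k<l\le m$ and all $1\le i\le m$ with $i\notin\{j,k,l\}$, $$\operatorname{dist}\big(f_i,\operatorname{lin}\{f_j,f_k,f_l\}\big)\ge\alpha,$$ where the distance is measured in the dual norm $\|g\|^\star=\sup\{|g(x)|:\|x\|\le1\}$. Let $\beta>0$ be a real number such that for all $1\le j<k\le m$ and all $x\in\mathbb{R}^n$, $$\max\{|f_j(x)|,|f_k(x)|\}\le\beta\max_{1\le i\le m,\ i\notin\{j,k\}}|f_i(x)|.$$ For a subspace $Y\subset X$ let $\lambda(Y,X)$ be the infimum of the operator norms $\|P\|$ over all linear $P:X\to Y$ with $P|_Y=\mathrm{id}_Y$. Then for every $(n-1)$-dimensional subspace $Y\subset X$ we have $\lambda(Y,X)>1+\varepsilon_0$,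 where $$\varepsilon_0=\left(m+2\beta^{2p}\right)^{-7}\left(\alpha^{-6}\,2^{14}\,n^{12}\,m^{11}\,p^{4}\right)^{-12pm}.$$ -/

import Mathlib

/-- The relative projection constant `λ(Y, X) = inf ‖P‖` of a subspace `Y` of a real normed space
`X`: the infimum is over all bounded linear operators `P` on `X` with values in `Y` such that
`P y = y` for all `y ∈ Y`.  (As `Y` carries the norm of `X`, it does not matter for `‖P‖` whether
`P` is regarded as an operator into `X` or into `Y`.) -/
noncomputable def relProjConst {X : Type*} [NormedAddCommGroup X] [NormedSpace ℝ X]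
    (Y : Submodule ℝ X) : ℝ :=
  sInf {r : ℝ | ∃ P : X →L[ℝ] X, (∀ x, P x ∈ Y) ∧ (∀ y ∈ Y, P y = y) ∧ r = ‖P‖}

/-- `ℝⁿ` as the underlying real vector space of the normed space whose norm is
`‖x‖ = (∑ i, |f i x| ^ (2 p)) ^ (1 / (2 p))`.  The conditions `0 < p` and `hf` (the functionals
have no common nonzero zero) say exactly that this formula defines a norm. -/
@[nolint unusedArguments]
def FunctionalSpace {n m : ℕ} (f : Fin m → Module.Dual ℝ (Fin n → ℝ)) (p : ℕ) (_hp : 0 < p)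
    (_hf : ∀ x, (∀ i, f i x = 0) → x = 0) : Type :=
  Fin n → ℝ

namespace FunctionalSpace

variable {n m : ℕ} {f : Fin m → Module.Dual ℝ (Fin n → ℝ)} {p : ℕ} {hp : 0 < p}
  {hf : ∀ x, (∀ i, f i x = 0) → x = 0}

instance : AddCommGroup (FunctionalSpace f p hp hf) := inferInstanceAs (AddCommGroup (Fin n → ℝ))

instance : Module ℝ (FunctionalSpace f p hp hf) := inferInstanceAs (Module ℝ (Fin n → ℝ))

instance : Module.Finite ℝ (FunctionalSpace f p hp hf) :=
  inferInstanceAs (Module.Finite ℝ (Fin n → ℝ))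

/-- The functional `f i`, as a linear functional on the space. -/
def functionalLin (hp : 0 < p) (hf : ∀ x, (∀ i, f i x = 0) → x = 0) (i : Fin m) :
    FunctionalSpace f p hp hf →ₗ[ℝ] ℝ :=
  f i

noncomputable instance : Norm (FunctionalSpace f p hp hf) :=
  ⟨fun x => (∑ i, |functionalLin hp hf i x| ^ (2 * p)) ^ (1 / (2 * p : ℝ))⟩

theorem norm_def (x : FunctionalSpace f p hp hf) :
    ‖x‖ = (∑ i, |functionalLin hp hf i x| ^ (2 * p)) ^ (1 / (2 * p : ℝ)) :=
  rfl

theorem norm_core : NormedSpace.Core ℝ (FunctionalSpace f p hp hf) := by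
  have hp1 : (1 : ℝ) ≤ p := by exact_mod_cast hp
  have hsum : ∀ x : FunctionalSpace f p hp hf,
      0 ≤ ∑ i, |functionalLin hp hf i x| ^ (2 * p) := fun x =>
    Finset.sum_nonneg fun i _ => by positivity
  refine ⟨⟨fun x => Real.rpow_nonneg (hsum x) _, fun c x => ?_, fun x y => ?_⟩, fun x => ?_⟩
  · have h : ∑ i, |functionalLin hp hf i (c • x)| ^ (2 * p)
        = |c| ^ (2 * p) * ∑ i, |functionalLin hp hf i x| ^ (2 * p) := by
      simp [Finset.mul_sum, abs_mul, mul_pow]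
    rw [norm_def, norm_def, h, Real.mul_rpow (by positivity) (hsum x), ← Real.rpow_natCast,
      ← Real.rpow_mul (abs_nonneg c), Real.norm_eq_abs]
    have : ((2 * p : ℕ) : ℝ) * (1 / (2 * p : ℝ)) = 1 := by push_cast; field_simp
    rw [this, Real.rpow_one]
  · have h := Real.Lp_add_le (Finset.univ : Finset (Fin m)) (p := (2 * p : ℝ))
      (fun i => functionalLin hp hf i x) (fun i => functionalLin hp hf i y) (by linarith)
    have e : ∀ a : ℝ, |a| ^ (2 * p : ℝ) = |a| ^ (2 * p) := fun a => by
      rw [← Real.rpow_natCast]; push_cast; rfl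
    simp only [e] at h
    simpa only [norm_def, map_add] using h
  · constructor
    · intro h
      rw [norm_def, Real.rpow_eq_zero (hsum x) (by positivity),
        Finset.sum_eq_zero_iff_of_nonneg (fun i _ => by positivity)] at h
      refine hf x fun i => ?_
      have := h i (Finset.mem_univ i)
      exact abs_eq_zero.1 (pow_eq_zero_iff (by omega) |>.1 this)
    · rintro rfl
      rw [norm_def, Real.rpow_eq_zero (hsum 0) (by positivity)]
      refine Finset.sum_eq_zero fun i _ => ?_
      rw [map_zero, abs_zero, zero_pow (by omega)]

noncomputable instance : NormedAddCommGroup (FunctionalSpace f p hp hf) :=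
  NormedAddCommGroup.ofCore norm_core

noncomputable instance : NormedSpace ℝ (FunctionalSpace f p hp hf) :=
  NormedSpace.ofCore norm_core

/-- The functional `f i`, as an element of the dual of the space; the norm on the dual is the
operator norm, that is, the norm dual to `‖x‖`. -/
noncomputable def functional (hp : 0 < p) (hf : ∀ x, (∀ i, f i x = 0) → x = 0) (i : Fin m) :
    StrongDual ℝ (FunctionalSpace f p hp hf) :=
  LinearMap.toContinuousLinearMap (functionalLin hp hf i)

end FunctionalSpace

/-!
A projection of norm close to `1` onto a hyperplane `ker g` provides a unit vector `w` that is
almost Birkhoff orthogonal to `ker g`. Expanding `‖y + t • w‖ ^ (2 * p)` to first order in `t`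
turns this into the smallness of `∑ i, F i w * F i y ^ (2 * p - 1)` for `y ∈ ker g`, and
polarization into that of `∑ i, F i w * ∏ s, F i (v s)` for all families of unit vectors of `ker g`.

If `F i` is far from `span {F j, g}` for all `j ≠ i`, then Hahn–Banach gives, for each such `j`, a
unit vector in `ker g ∩ ker (F j)` on which `F i` is not small; feeding these vectors to the
multilinear form isolates the term `i`, so `F i w` is small. As no `F i` is close to the span of
three others, at most two of the `F i` fail to be far in this sense. Hence all but two of the
coordinates `F i w` are small, by domination so are the remaining two, and `‖w‖ = 1` is impossible
unless the projection has norm bounded away from `1`.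
-/

open Finset
open scoped Nat

section Polarization

variable {R σ : Type*} [CommRing R] [Fintype σ]

theorem sum_neg_one_pow_card_of_superset [DecidableEq σ] (T : Finset σ) :
    ∑ S with T ⊆ S, (-1 : R) ^ #S = if T = univ then (-1) ^ Fintype.card σ else 0 := by
  have reindex : ∑ S with T ⊆ S, (-1 : R) ^ #S =
      ∑ U ∈ Tᶜ.powerset, (-1 : R) ^ #U * (-1) ^ Fintype.card σ := by
    refine sum_nbij' compl compl (by simp) (by simp [subset_compl_comm]) (by simp) (by simp)
      fun S _ => ?_
    rw [← card_add_card_compl S, add_comm, pow_add, ← mul_assoc, ← mul_pow]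
    simp
  have alternating : ∑ U ∈ Tᶜ.powerset, (-1 : R) ^ #U = 0 ^ #Tᶜ := by
    simpa using sum_pow_mul_eq_add_pow (-1 : R) 1 Tᶜ
  rw [reindex, ← sum_mul, alternating, zero_pow_eq]
  simp

theorem card_filter_surjective_self [DecidableEq σ] :
    #{c : σ → σ | Function.Surjective c} = (Fintype.card σ)! := by
  simp_rw [← Finite.injective_iff_surjective]
  rw [← Fintype.card_subtype, Fintype.card_congr (Equiv.subtypeInjectiveEquivEmbedding σ σ),
    Fintype.card_embedding_eq, Nat.descFactorial_self]

theorem sum_neg_one_pow_card_mul_sum_pow (a : σ → R) :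
    ∑ S : Finset σ, (-1) ^ #S * (∑ s ∈ S, a s) ^ Fintype.card σ =
      (-1) ^ Fintype.card σ * (Fintype.card σ)! * ∏ s, a s := by
  classical
  have expand (S : Finset σ) : (∑ s ∈ S, a s) ^ Fintype.card σ =
      ∑ c : σ → σ with univ.image c ⊆ S, ∏ k, a (c k) := by
    rw [← card_univ, ← prod_const, prod_univ_sum]
    congr 1
    ext c
    simp [Fintype.mem_piFinset, image_subset_iff]
  calc
    _ = ∑ c : σ → σ, (∑ S with univ.image c ⊆ S, (-1) ^ #S) * ∏ k, a (c k) := by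
      simp_rw [expand, sum_filter, mul_sum, sum_mul, mul_ite, ite_mul, mul_zero, zero_mul]
      exact sum_comm
    _ = ∑ c : σ → σ with Function.Surjective c, (-1) ^ Fintype.card σ * ∏ s, a s := by
      rw [sum_filter]
      refine sum_congr rfl fun c _ => ?_
      have image_eq_univ : univ.image c = univ ↔ Function.Surjective c := by
        simp [eq_univ_iff_forall, Function.Surjective]
      simp only [sum_neg_one_pow_card_of_superset, image_eq_univ, ite_mul, zero_mul]
      split_ifs with hc
      · rw [(Finite.surjective_iff_bijective.1 hc).prod_comp a]
      · rfl
    _ = _ := by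
      rw [sum_const, card_filter_surjective_self, nsmul_eq_mul]
      ring

end Polarization

section PowerSums

variable {X ι : Type*} [NormedAddCommGroup X] [NormedSpace ℝ X] [Fintype ι]
  {F : ι → Module.Dual ℝ X} {w : ι → ℝ} {d : ℕ} {η : ℝ}

theorem abs_sum_mul_pow_le_mul_norm_pow (h : ∀ y, ‖y‖ ≤ 1 → |∑ i, w i * F i y ^ d| ≤ η) (y : X) :
    |∑ i, w i * F i y ^ d| ≤ η * ‖y‖ ^ d := by
  rcases eq_or_ne y 0 with rfl | hy
  · rcases eq_or_ne d 0 with rfl | hd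
    · simpa using h 0
    · simp [hd]
  have hy' : 0 < ‖y‖ := norm_pos_iff.2 hy
  have homogeneous : ∑ i, w i * F i y ^ d = (∑ i, w i * F i (‖y‖⁻¹ • y) ^ d) * ‖y‖ ^ d := by
    rw [sum_mul]
    refine sum_congr rfl fun i _ => ?_
    rw [map_smul, smul_eq_mul, mul_pow, inv_pow]
    field_simp
  rw [homogeneous, abs_mul, abs_of_nonneg (pow_nonneg hy'.le d)]
  gcongr
  exact h _ (by simp [norm_smul, hy'.ne'])

theorem abs_sum_mul_prod_le (h : ∀ y, ‖y‖ ≤ 1 → |∑ i, w i * F i y ^ d| ≤ η)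
    {v : Fin d → X} (hv : ∀ s, ‖v s‖ ≤ 1) :
    |∑ i, w i * ∏ s, F i (v s)| ≤ (2 * d) ^ d * η := by
  have hη : 0 ≤ η := (abs_nonneg _).trans (h 0 (by simp))
  have bound (S : Finset (Fin d)) : |∑ i, w i * (∑ s ∈ S, F i (v s)) ^ d| ≤ d ^ d * η := by
    have norm_sum_le : ‖∑ s ∈ S, v s‖ ≤ d :=
      (norm_sum_le_of_le S fun s _ => hv s).trans (by simpa using S.card_le_univ)
    simp_rw [← map_sum, mul_comm _ η]
    exact (abs_sum_mul_pow_le_mul_norm_pow h _).trans (by gcongr)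
  have polarization :
      ∑ S : Finset (Fin d), (-1) ^ #S * ∑ i, w i * (∑ s ∈ S, F i (v s)) ^ d =
        (-1) ^ d * d ! * ∑ i, w i * ∏ s, F i (v s) := by
    simp_rw [mul_sum, mul_left_comm _ (w _)]
    rw [sum_comm]
    refine sum_congr rfl fun i _ => ?_
    rw [← mul_sum]
    congr 1
    simpa using sum_neg_one_pow_card_mul_sum_pow fun s => F i (v s)
  calc
    |∑ i, w i * ∏ s, F i (v s)| ≤ d ! * |∑ i, w i * ∏ s, F i (v s)| :=
      le_mul_of_one_le_left (abs_nonneg _) (mod_cast d.factorial_pos)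
    _ = |∑ S : Finset (Fin d), (-1) ^ #S * ∑ i, w i * (∑ s ∈ S, F i (v s)) ^ d| := by
      simp [polarization, abs_mul]
    _ ≤ ∑ S : Finset (Fin d), |∑ i, w i * (∑ s ∈ S, F i (v s)) ^ d| :=
      (abs_sum_le_sum_abs _ _).trans_eq (by simp [abs_mul])
    _ ≤ ∑ _S : Finset (Fin d), d ^ d * η := sum_le_sum fun S _ => bound S
    _ = (2 * d) ^ d * η := by simp [mul_pow, mul_assoc]

theorem abs_mul_pow_le_of_exists_apply_eq_zero [Nontrivial ι] {γ : ℝ} {i : ι}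
    (h : ∀ y, ‖y‖ ≤ 1 → |∑ i, w i * F i y ^ d| ≤ η) (hcard : Fintype.card ι ≤ d + 1)
    (hγ : 0 ≤ γ) (hi : ∀ j, j ≠ i → ∃ v, ‖v‖ ≤ 1 ∧ F j v = 0 ∧ γ ≤ |F i v|) :
    |w i| * γ ^ d ≤ (2 * d) ^ d * η := by
  classical
  obtain ⟨q, hq⟩ : ∃ q : Fin d → {j // j ≠ i}, Function.Surjective q := by
    have : Nonempty {j // j ≠ i} := nonempty_subtype.2 (exists_ne i)
    refine Function.exists_surjective_iff.2
      ⟨inferInstance, Function.Embedding.nonempty_of_card_le ?_⟩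
    rw [Fintype.card_subtype_compl, Fintype.card_fin, Fintype.card_subtype_eq]
    lia
  choose v hv hv0 hvi using fun s => hi (q s) (q s).2
  have only_i : ∑ j, w j * ∏ s, F j (v s) = w i * ∏ s, F i (v s) := by
    refine Fintype.sum_eq_single i fun j hj => mul_eq_zero_of_right _ ?_
    obtain ⟨s, hs⟩ := hq ⟨j, hj⟩
    exact prod_eq_zero (mem_univ s) (by simpa [hs] using hv0 s)
  calc
    |w i| * γ ^ d = |w i| * ∏ _s : Fin d, γ := by simp
    _ ≤ |w i| * ∏ s, |F i (v s)| := by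
      gcongr with s
      exact hvi s
    _ = |∑ j, w j * ∏ s, F j (v s)| := by rw [only_i, abs_mul, abs_prod]
    _ ≤ (2 * d) ^ d * η := abs_sum_mul_prod_le h hv

end PowerSums

theorem abs_add_pow_sub_le {x u : ℝ} (hx : |x| ≤ 1) (hu : |u| ≤ 1) (n : ℕ) :
    |(x + u) ^ n - x ^ n - n * x ^ (n - 1) * u| ≤ 2 ^ n * u ^ 2 := by
  suffices h : |(x + u) ^ n - x ^ n - n * x ^ (n - 1) * u| ≤ (2 ^ n - n - 1) * u ^ 2 from
    h.trans <| by gcongr; linarith [n.cast_nonneg (α := ℝ)]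
  induction n with
  | zero => simp
  | succ n ih =>
    have remainder_succ : (x + u) ^ (n + 1) - x ^ (n + 1) - (n + 1 : ℕ) * x ^ (n + 1 - 1) * u =
        (x + u) * ((x + u) ^ n - x ^ n - n * x ^ (n - 1) * u) + n * x ^ (n - 1) * u ^ 2 := by
      cases n with
      | zero => simp
      | succ k => push_cast; ring
    have abs_add_le_two : |x + u| ≤ 2 := (abs_add_le x u).trans (by linarith)
    have abs_pow_le_one : |x| ^ (n - 1) ≤ 1 := pow_le_one₀ (abs_nonneg x) hx
    calc
      _ ≤ |x + u| * |(x + u) ^ n - x ^ n - n * x ^ (n - 1) * u| + n * |x| ^ (n - 1) * u ^ 2 := by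
        rw [remainder_succ]
        exact (abs_add_le _ _).trans_eq (by simp [abs_mul])
      _ ≤ 2 * ((2 ^ n - n - 1) * u ^ 2) + n * 1 * u ^ 2 := by gcongr
      _ = (2 ^ (n + 1) - (n + 1 : ℕ) - 1) * u ^ 2 := by push_cast; ring

/-- `∑ i, F i x ^ (2 * p) = ‖x‖ ^ (2 * p)`: the functionals `F i` embed `X` isometrically into
`ℓ^(2p)`. The exponent is even, so no absolute values are needed. -/
def IsEvenPowerNorming {X ι : Type*} [NormedAddCommGroup X] [NormedSpace ℝ X] [Fintype ι]
    (F : ι → StrongDual ℝ X) (p : ℕ) : Prop :=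
  ∀ x, ∑ i, F i x ^ (2 * p) = ‖x‖ ^ (2 * p)

namespace IsEvenPowerNorming

variable {X ι : Type*} [NormedAddCommGroup X] [NormedSpace ℝ X] [Fintype ι]
  {F : ι → StrongDual ℝ X} {p : ℕ}

theorem abs_apply_le_norm (hF : IsEvenPowerNorming F p) (hp : p ≠ 0) (i : ι) (x : X) :
    |F i x| ≤ ‖x‖ := by
  refine le_of_pow_le_pow_left₀ (n := 2 * p) (by lia) (norm_nonneg x) ?_
  rw [(even_two_mul p).pow_abs, ← hF]
  exact single_le_sum (f := fun i => F i x ^ (2 * p))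
    (fun j _ => (even_two_mul p).pow_nonneg _) (mem_univ i)

theorem norm_add_smul_pow_le (hF : IsEvenPowerNorming F p) (hp : p ≠ 0) {w y : X} (hw : ‖w‖ ≤ 1)
    (hy : ‖y‖ ≤ 1) {t : ℝ} (ht : |t| ≤ 1) :
    ‖y + t • w‖ ^ (2 * p) ≤ ‖y‖ ^ (2 * p) + 2 * p * (t * ∑ i, F i w * F i y ^ (2 * p - 1)) +
      4 ^ p * Fintype.card ι * t ^ 2 := by
  have term_le (i : ι) : F i (y + t • w) ^ (2 * p) ≤
      F i y ^ (2 * p) + 2 * p * (t * (F i w * F i y ^ (2 * p - 1))) + 4 ^ p * t ^ 2 := by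
    have hw1 : |F i w| ≤ 1 := (hF.abs_apply_le_norm hp i w).trans hw
    have taylor := abs_add_pow_sub_le ((hF.abs_apply_le_norm hp i y).trans hy)
      (u := t * F i w) (by rw [abs_mul]; exact mul_le_one₀ ht (abs_nonneg _) hw1) (2 * p)
    have sq_le : (t * F i w) ^ 2 ≤ t ^ 2 := by
      rw [mul_pow]
      exact mul_le_of_le_one_right (sq_nonneg t) ((sq_le_one_iff_abs_le_one _).2 hw1)
    calc
      _ = (F i y + t * F i w) ^ (2 * p) := by simp
      _ ≤ F i y ^ (2 * p) + (2 * p : ℕ) * F i y ^ (2 * p - 1) * (t * F i w) +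
          2 ^ (2 * p) * (t * F i w) ^ 2 := by linarith [(abs_le.1 taylor).2]
      _ ≤ F i y ^ (2 * p) + (2 * p : ℕ) * F i y ^ (2 * p - 1) * (t * F i w) +
          2 ^ (2 * p) * t ^ 2 := by gcongr
      _ = _ := by rw [pow_mul 2 2 p]; push_cast; ring
  calc
    ‖y + t • w‖ ^ (2 * p) = ∑ i, F i (y + t • w) ^ (2 * p) := (hF _).symm
    _ ≤ ∑ i, (F i y ^ (2 * p) + 2 * p * (t * (F i w * F i y ^ (2 * p - 1))) + 4 ^ p * t ^ 2) :=
      sum_le_sum fun i _ => term_le i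
    _ = _ := by
      rw [sum_add_distrib, sum_add_distrib, ← mul_sum, ← mul_sum, hF]
      simp only [sum_const, card_univ, nsmul_eq_mul, add_right_inj]
      ring

theorem abs_sum_apply_mul_pow_le (hF : IsEvenPowerNorming F p) (hp : p ≠ 0) {w y : X}
    (hw : ‖w‖ ≤ 1) (hy : ‖y‖ ≤ 1) {τ : ℝ} (hτ0 : 0 < τ) (hτ1 : τ ≤ 1)
    (h : ∀ t : ℝ, ‖y‖ ^ (2 * p) ≤ (1 + τ ^ 2) * ‖y + t • w‖ ^ (2 * p)) :
    |∑ i, F i w * F i y ^ (2 * p - 1)| ≤ 4 ^ p * (Fintype.card ι + 1) * τ := by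
  set Q := ∑ i, F i w * F i y ^ (2 * p - 1)
  obtain ⟨t, ht, htQ⟩ : ∃ t : ℝ, |t| = τ ∧ t * Q = -(τ * |Q|) := by
    rcases abs_choice Q with hQ | hQ
    · exact ⟨-τ, by simp [hτ0.le], by rw [hQ]; ring⟩
    · exact ⟨τ, abs_of_pos hτ0, by rw [hQ]; ring⟩
  have upper := hF.norm_add_smul_pow_le hp hw hy (ht.trans_le hτ1)
  rw [htQ, ← sq_abs t, ht] at upper
  have crude : ‖y + t • w‖ ^ (2 * p) ≤ 4 ^ p := by
    have norm_le_two : ‖y + t • w‖ ≤ 2 := by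
      refine (norm_add_le_of_le hy (?_ : ‖t • w‖ ≤ 1)).trans_eq one_add_one_eq_two
      rw [norm_smul, Real.norm_eq_abs, ht]
      exact mul_le_one₀ hτ1 (norm_nonneg w) hw
    calc
      ‖y + t • w‖ ^ (2 * p) ≤ 2 ^ (2 * p) := by gcongr
      _ = 4 ^ p := by rw [pow_mul]; norm_num
  have hp1 : (1 : ℝ) ≤ 2 * p := mod_cast (by lia : 1 ≤ 2 * p)
  refine le_of_mul_le_mul_left ?_ hτ0
  calc
    τ * |Q| ≤ 2 * p * (τ * |Q|) := le_mul_of_one_le_left (by positivity) hp1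
    _ ≤ τ ^ 2 * ‖y + t • w‖ ^ (2 * p) + 4 ^ p * Fintype.card ι * τ ^ 2 := by linarith [h t]
    _ ≤ τ ^ 2 * 4 ^ p + 4 ^ p * Fintype.card ι * τ ^ 2 := by gcongr
    _ = τ * (4 ^ p * (Fintype.card ι + 1) * τ) := by ring

end IsEvenPowerNorming

theorem exists_apply_eq_zero_lt_norm_apply {𝕜 E κ : Type*} [RCLike 𝕜] [NormedAddCommGroup E]
    [NormedSpace 𝕜 E] [Finite κ] {f : StrongDual 𝕜 E} {g : κ → StrongDual 𝕜 E} {γ : ℝ}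
    (h : ∀ χ ∈ Submodule.span 𝕜 (Set.range g), γ < ‖f - χ‖) :
    ∃ v, ‖v‖ < 1 ∧ (∀ k, g k v = 0) ∧ γ < ‖f v‖ := by
  cases nonempty_fintype κ
  set Z : Submodule 𝕜 E := ⨅ k, (g k).ker
  -- A norm-preserving extension of `f` from `Z` differs from `f` by an element of the span.
  obtain ⟨e, he, norm_e⟩ := exists_extension_norm_eq Z (f.comp Z.subtypeL)
  have sub_mem : f - e ∈ Submodule.span 𝕜 (Set.range g) := by
    have ker_le : Z ≤ (f - e).ker := fun v hv => by simpa [sub_eq_zero] using (he ⟨v, hv⟩).symm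
    obtain ⟨c, hc⟩ := (Submodule.mem_span_range_iff_exists_fun 𝕜).1
      (mem_span_of_iInf_ker_le_ker ker_le)
    exact (Submodule.mem_span_range_iff_exists_fun 𝕜).2
      ⟨c, ContinuousLinearMap.coe_injective (by simpa using hc)⟩
  obtain ⟨v, hv, hfv⟩ := ContinuousLinearMap.exists_lt_apply_of_lt_opNorm (f.comp Z.subtypeL)
    (by simpa [norm_e] using h _ sub_mem)
  exact ⟨v, hv, fun k => (Submodule.mem_iInf _).1 v.2 k, hfv⟩

section Separation

variable {E ι : Type*} [NormedAddCommGroup E] [NormedSpace ℝ E]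

/-- Every `F i` has distance at least `α` from the span of any three others. The indices `j`, `k`,
`l` may coincide, which is no restriction when there are at least four indices. -/
def IsTripleSeparated (F : ι → E) (α : ℝ) : Prop :=
  ∀ ⦃i j k l⦄, i ≠ j → i ≠ k → i ≠ l → α ≤ Metric.infDist (F i) (Submodule.span ℝ {F j, F k, F l})

theorem IsTripleSeparated.le_norm_sub {F : ι → E} {α : ℝ} (hF : IsTripleSeparated F α)
    {i j k l : ι} (hij : i ≠ j) (hik : i ≠ k) (hil : i ≠ l) {x : E}
    (hx : x ∈ Submodule.span ℝ {F j, F k, F l}) : α ≤ ‖F i - x‖ :=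
  (hF hij hik hil).trans <| (Metric.infDist_le_dist_of_mem hx).trans_eq (dist_eq_norm _ _)

theorem IsTripleSeparated.of_lt [LinearOrder ι] [Fintype ι] {F : ι → E} {α : ℝ}
    (hcard : 4 ≤ Fintype.card ι)
    (h : ∀ j k l, j < k → k < l → ∀ i, i ≠ j → i ≠ k → i ≠ l →
      α ≤ Metric.infDist (F i) (Submodule.span ℝ {F j, F k, F l})) :
    IsTripleSeparated F α := by
  intro i j k l hij hik hil
  obtain ⟨T, hT, hTi, hT3⟩ := exists_subsuperset_card_eq (s := {j, k, l}) (t := univ.erase i)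
    (n := 3) (by simp [insert_subset_iff, hij.symm, hik.symm, hil.symm]) card_le_three
    (by rw [card_erase_of_mem (mem_univ i), card_univ]; lia)
  set e := T.orderEmbOfFin hT3
  have ne_e (t : Fin 3) : i ≠ e t := (ne_of_mem_erase (hTi (T.orderEmbOfFin_mem hT3 t))).symm
  refine (h (e 0) (e 1) (e 2) (e.strictMono (by decide)) (e.strictMono (by decide)) i
    (ne_e 0) (ne_e 1) (ne_e 2)).trans (Metric.infDist_le_infDist_of_subset ?_ ⟨0, zero_mem _⟩)
  refine Submodule.span_mono fun x hx => ?_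
  have range_e : Set.range e = T := T.range_orderEmbOfFin hT3
  have mem_T : x ∈ F '' T := by
    rcases hx with rfl | rfl | rfl <;> exact Set.mem_image_of_mem F (hT (by simp))
  rw [← range_e, ← Set.range_comp] at mem_T
  obtain ⟨t, rfl⟩ := mem_T
  fin_cases t <;> simp

/-- `F i` lies within `γ` of the line `s • g + ℝ ∙ F j`, for some `j ≠ i`. -/
def IsNearLine (F : ι → E) (g : E) (γ : ℝ) (i j : ι) (s : ℝ) : Prop :=
  i ≠ j ∧ ∃ c : ℝ, ‖F i - c • F j - s • g‖ ≤ γ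

-- Subtracting `s / t` times the second approximation from the first eliminates `g`.
theorem IsNearLine.eq_of_abs_le {F : ι → E} {g : E} {α γ : ℝ} {i j k l : ι} {s t : ℝ}
    (hi : IsNearLine F g γ i j s) (hk : IsNearLine F g γ k l t)
    (hF : IsTripleSeparated F α) (hγ : 2 * γ < α) (hik : i ≠ k) (hst : |s| ≤ |t|) : i = l := by
  by_contra hil
  obtain ⟨hij, c, hc⟩ := hi
  obtain ⟨-, d, hd⟩ := hk
  have ratio_mul : s / t * t = s := div_mul_cancel_of_imp fun ht => by simpa [ht] using hst
  have abs_ratio : |s / t| ≤ 1 := by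
    rw [abs_div]
    exact div_le_one_of_le₀ hst (abs_nonneg t)
  have mem_span : c • F j + (s / t) • (F k - d • F l) ∈ Submodule.span ℝ {F j, F k, F l} := by
    rw [Submodule.mem_span_triple]
    exact ⟨c, s / t, -(s / t * d), by module⟩
  have eliminate : F i - (c • F j + (s / t) • (F k - d • F l)) =
      (F i - c • F j - s • g) - (s / t) • (F k - d • F l - t • g) := by
    conv_rhs => rw [smul_sub _ _ (t • g), smul_smul, ratio_mul]
    module
  have : α ≤ γ + 1 * γ := calc
    α ≤ ‖F i - (c • F j + (s / t) • (F k - d • F l))‖ := hF.le_norm_sub hij hik hil mem_span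
    _ ≤ ‖F i - c • F j - s • g‖ + |s / t| * ‖F k - d • F l - t • g‖ := by
      rw [eliminate, ← Real.norm_eq_abs, ← norm_smul]
      exact norm_sub_le _ _
    _ ≤ γ + 1 * γ := by gcongr
  linarith

theorem IsTripleSeparated.exists_pair_of_isNearLine [Finite ι] [Nontrivial ι] {F : ι → E}
    {α γ : ℝ} (hF : IsTripleSeparated F α) (hγ : 2 * γ < α) (g : E) :
    ∃ a b, a ≠ b ∧ ∀ i j s, IsNearLine F g γ i j s → i = a ∨ i = b := by
  by_cases h : ∃ i j s, IsNearLine F g γ i j s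
  · have : Nonempty {i // ∃ j s, IsNearLine F g γ i j s} := nonempty_subtype.2 h
    choose j s hjs using fun i : {i // ∃ j s, IsNearLine F g γ i j s} => i.2
    obtain ⟨k, hk⟩ := Finite.exists_max fun i => |s i|
    refine ⟨k, j k, (hjs k).1, fun i j' s' hi => or_iff_not_imp_left.2 fun hik => ?_⟩
    let i' : {i // ∃ j s, IsNearLine F g γ i j s} := ⟨i, j', s', hi⟩
    exact (hjs i').eq_of_abs_le (hjs k) hF hγ hik (hk i')
  · obtain ⟨a, b, hab⟩ := exists_pair_ne ι
    exact ⟨a, b, hab, fun i j s hi => absurd ⟨i, j, s, hi⟩ h⟩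

end Separation

theorem IsTripleSeparated.exists_pair_abs_mul_pow_le {X ι : Type*} [NormedAddCommGroup X]
    [NormedSpace ℝ X] [Fintype ι] [Nontrivial ι] {F : ι → StrongDual ℝ X} {α γ η : ℝ}
    (hF : IsTripleSeparated F α) (hγ0 : 0 ≤ γ) (hγ : 2 * γ < α) {d : ℕ}
    (hcard : Fintype.card ι ≤ d + 1) {w : ι → ℝ} {g : StrongDual ℝ X}
    (h : ∀ y ∈ g.ker, ‖y‖ ≤ 1 → |∑ i, w i * F i y ^ d| ≤ η) :
    ∃ a b, a ≠ b ∧ ∀ i, i ≠ a → i ≠ b → |w i| * γ ^ d ≤ (2 * d) ^ d * η := by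
  obtain ⟨a, b, hab, near⟩ := hF.exists_pair_of_isNearLine hγ g
  refine ⟨a, b, hab, fun i hia hib => ?_⟩
  refine abs_mul_pow_le_of_exists_apply_eq_zero
    (F := fun j => (F j : X →ₗ[ℝ] ℝ).domRestrict g.ker) (fun y => h y y.2) hcard hγ0 fun j hj => ?_
  have far : ∀ χ ∈ Submodule.span ℝ (Set.range ![F j, g]), γ < ‖F i - χ‖ := by
    intro χ hχ
    rw [Matrix.range_cons_cons_empty, Submodule.mem_span_pair] at hχ
    obtain ⟨c, s, rfl⟩ := hχ
    rw [← sub_sub]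
    exact not_le.1 fun hle => (near i j s ⟨hj.symm, c, hle⟩).elim hia hib
  obtain ⟨v, hv, hv0, hiv⟩ := exists_apply_eq_zero_lt_norm_apply far
  exact ⟨⟨v, hv0 1⟩, hv.le, hv0 0, hiv.le⟩

/-- Any two coordinates `F j x`, `F k x` are bounded by `β` times the largest of the others. The
condition is symmetric in `j` and `k`, so it suffices to bound `F j x`. -/
def IsPairDominated {X ι : Type*} [NormedAddCommGroup X] [NormedSpace ℝ X]
    (F : ι → StrongDual ℝ X) (β : ℝ) : Prop :=
  ∀ ⦃j k⦄, j ≠ k → ∀ x, |F j x| ≤ β * ⨆ i : {i // i ≠ j ∧ i ≠ k}, |F i x|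

section Hyperplane

variable {X ι : Type*} [NormedAddCommGroup X] [NormedSpace ℝ X] {F : ι → StrongDual ℝ X}
  {p : ℕ} {α β : ℝ} {Y : Submodule ℝ X}

theorem IsPairDominated.apply_pow_le (hF : IsPairDominated F β) {j k : ι} (hjk : j ≠ k) {x : X}
    {σ : ℝ} (hσ : 0 ≤ σ) (hx : ∀ i, i ≠ j → i ≠ k → |F i x| ≤ σ) :
    F j x ^ (2 * p) ≤ β ^ (2 * p) * σ ^ (2 * p) := by
  set S := ⨆ i : {i // i ≠ j ∧ i ≠ k}, |F i x|
  have hS0 : 0 ≤ S := Real.iSup_nonneg fun _ => abs_nonneg _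
  have hS : S ≤ σ := Real.iSup_le (fun i => hx i i.2.1 i.2.2) hσ
  calc
    F j x ^ (2 * p) = |F j x| ^ (2 * p) := ((even_two_mul p).pow_abs _).symm
    _ ≤ (β * S) ^ (2 * p) := by
      gcongr
      exact hF hjk x
    _ ≤ β ^ (2 * p) * σ ^ (2 * p) := by
      rw [mul_pow]
      gcongr
      exact (even_two_mul p).pow_nonneg β

theorem IsEvenPowerNorming.norm_pow_le [Fintype ι] (hF : IsEvenPowerNorming F p)
    (hβ : IsPairDominated F β) {a b : ι} (hab : a ≠ b) {x : X} {σ : ℝ} (hσ : 0 ≤ σ)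
    (hx : ∀ i, i ≠ a → i ≠ b → |F i x| ≤ σ) :
    ‖x‖ ^ (2 * p) ≤ (Fintype.card ι + 2 * β ^ (2 * p)) * σ ^ (2 * p) := by
  classical
  have other_le : ∑ i ∈ {a, b}ᶜ, F i x ^ (2 * p) ≤ Fintype.card ι * σ ^ (2 * p) := calc
    _ ≤ ∑ _i ∈ {a, b}ᶜ, σ ^ (2 * p) := sum_le_sum fun i hi => by
      obtain ⟨hia, hib⟩ : i ≠ a ∧ i ≠ b := by simpa using hi
      rw [← (even_two_mul p).pow_abs]
      gcongr
      exact hx i hia hib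
    _ ≤ Fintype.card ι * σ ^ (2 * p) := by
      rw [sum_const, nsmul_eq_mul]
      gcongr
      exact card_le_univ _
  rw [← hF, ← sum_add_sum_compl {a, b}, sum_pair hab]
  linarith [hβ.apply_pow_le (p := p) hab hσ hx,
    hβ.apply_pow_le (p := p) hab.symm hσ fun i hib hia => hx i hia hib]

theorem exists_norm_eq_one_forall_norm_le_of_isProj {P : X →L[ℝ] X}
    (hP : LinearMap.IsProj Y P) (hY : Y ≠ ⊤) :
    ∃ w : X, ‖w‖ = 1 ∧ ∀ y ∈ Y, ∀ t : ℝ, ‖y‖ ≤ ‖P‖ * ‖y + t • w‖ := by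
  obtain ⟨x, -, hx⟩ := SetLike.exists_of_lt hY.lt_top
  have sub_ne_zero : x - P x ≠ 0 := fun h => hx (sub_eq_zero.1 h ▸ hP.map_mem x)
  have map_sub_eq_zero : P (x - P x) = 0 := by rw [map_sub, hP.map_id _ (hP.map_mem x), sub_self]
  refine ⟨‖x - P x‖⁻¹ • (x - P x), norm_smul_inv_norm sub_ne_zero, fun y hy t => ?_⟩
  calc
    ‖y‖ = ‖P (y + t • ‖x - P x‖⁻¹ • (x - P x))‖ := by
      simp [-map_sub, map_sub_eq_zero, hP.map_id y hy]
    _ ≤ _ := P.le_opNorm _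

theorem exists_strongDual_ker_eq_of_isCoatom [FiniteDimensional ℝ X] (hY : IsCoatom Y) :
    ∃ g : StrongDual ℝ X, g.ker = Y := by
  obtain ⟨g, hg0, hg⟩ := Y.exists_le_ker_of_lt_top hY.lt_top
  have ker_ne_top : g.ker ≠ ⊤ := fun h => hg0 (LinearMap.ker_eq_top.1 h)
  exact ⟨g.toContinuousLinearMap, (hY.le_iff_eq ker_ne_top).1 hg⟩

theorem IsTripleSeparated.le_one [Nontrivial ι] (hsep : IsTripleSeparated F α)
    (hF : ∀ i x, |F i x| ≤ ‖x‖) : α ≤ 1 := by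
  obtain ⟨i, j, hij⟩ := exists_pair_ne ι
  calc
    α ≤ ‖F i - 0‖ := hsep.le_norm_sub hij hij hij (zero_mem _)
    _ ≤ 1 := by
      rw [sub_zero]
      exact (F i).opNorm_le_bound zero_le_one fun x => by simpa using hF i x

theorem IsEvenPowerNorming.finiteDimensional [Fintype ι] (hF : IsEvenPowerNorming F p)
    (hp : p ≠ 0) : FiniteDimensional ℝ X := by
  refine .of_injective (LinearMap.pi fun i => (F i : X →ₗ[ℝ] ℝ)) <|
    (injective_iff_map_eq_zero _).2 fun x hx => norm_eq_zero.1 <| pow_eq_zero_iff (n := 2 * p)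
      (by lia) |>.1 ?_
  rw [← hF]
  exact sum_eq_zero fun i _ => by
    rw [show F i x = 0 from congrFun hx i, zero_pow (by lia)]

/-- If `w` is a unit vector with `‖y‖ ^ (2 * p) ≤ (1 + τ ^ 2) * ‖y + t • w‖ ^ (2 * p)` on a
hyperplane, then all but two of the coordinates of `w` are at most this constant times `τ`. -/
noncomputable def coordinateConst (m p : ℕ) (α : ℝ) : ℝ :=
  (12 * p / α) ^ (2 * p - 1) * (4 ^ p * (m + 1))

theorem one_le_coordinateConst {m : ℕ} (hp : p ≠ 0) (hα0 : 0 < α) (hα1 : α ≤ 1) :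
    1 ≤ coordinateConst m p α := by
  have hp1 : (1 : ℝ) ≤ p := mod_cast Nat.one_le_iff_ne_zero.2 hp
  have base : 1 ≤ 12 * p / α := (one_le_div hα0).2 (by linarith)
  have hm : (1 : ℝ) ≤ m + 1 := by simp
  exact one_le_mul_of_one_le_of_one_le (one_le_pow₀ base)
    (one_le_mul_of_one_le_of_one_le (one_le_pow₀ (by norm_num)) hm)

variable [Fintype ι] [Nontrivial ι]

variable (ι p β) in
theorem one_lt_card_add_two_mul_pow : 1 < Fintype.card ι + 2 * β ^ (2 * p) := by
  have : (1 : ℝ) < Fintype.card ι := mod_cast Fintype.one_lt_card (α := ι)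
  linarith [(even_two_mul p).pow_nonneg β]

theorem IsEvenPowerNorming.exists_pair_abs_apply_le (hF : IsEvenPowerNorming F p)
    (hcard : Fintype.card ι ≤ 2 * p) (hα : 0 < α) (hsep : IsTripleSeparated F α)
    {g : StrongDual ℝ X} {w : X} (hw : ‖w‖ ≤ 1) {τ : ℝ} (hτ0 : 0 < τ) (hτ1 : τ ≤ 1)
    (h : ∀ y ∈ g.ker, ∀ t : ℝ, ‖y‖ ^ (2 * p) ≤ (1 + τ ^ 2) * ‖y + t • w‖ ^ (2 * p)) :
    ∃ a b, a ≠ b ∧ ∀ i, i ≠ a → i ≠ b → |F i w| ≤ coordinateConst (Fintype.card ι) p α * τ := by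
  have hp : p ≠ 0 := by have := Fintype.one_lt_card (α := ι); lia
  obtain ⟨a, b, hab, small⟩ := hsep.exists_pair_abs_mul_pow_le (γ := α / 3) (by positivity)
    (by linarith) (d := 2 * p - 1) (by lia) fun y hy hy1 =>
      hF.abs_sum_apply_mul_pow_le hp hw hy1 hτ0 hτ1 (h y hy)
  refine ⟨a, b, hab, fun i hia hib => ?_⟩
  calc
    |F i w| ≤ (2 * (2 * p - 1 : ℕ)) ^ (2 * p - 1) * (4 ^ p * (Fintype.card ι + 1) * τ) /
        (α / 3) ^ (2 * p - 1) := (le_div_iff₀ (by positivity)).2 (small i hia hib)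
    _ ≤ (2 * (2 * p : ℕ)) ^ (2 * p - 1) * (4 ^ p * (Fintype.card ι + 1) * τ) /
        (α / 3) ^ (2 * p - 1) := by
      gcongr
      exact Nat.sub_le _ _
    _ = coordinateConst (Fintype.card ι) p α * τ := by
      rw [coordinateConst, mul_div_right_comm, ← div_pow, ← mul_assoc]
      congr 3
      push_cast
      field_simp
      norm_num

theorem one_le_mul_pow_of_isProj (hF : IsEvenPowerNorming F p) (hcard : Fintype.card ι ≤ 2 * p)
    (hα : 0 < α) (hsep : IsTripleSeparated F α) (hβ : IsPairDominated F β) (hY : IsCoatom Y)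
    {P : X →L[ℝ] X} (hP : LinearMap.IsProj Y P) {τ : ℝ} (hτ0 : 0 < τ) (hτ1 : τ ≤ 1)
    (hPτ : ‖P‖ ^ (2 * p) ≤ 1 + τ ^ 2) :
    1 ≤ (Fintype.card ι + 2 * β ^ (2 * p)) *
      (coordinateConst (Fintype.card ι) p α * τ) ^ (2 * p) := by
  have hp : p ≠ 0 := by have := Fintype.one_lt_card (α := ι); lia
  have := hF.finiteDimensional hp
  obtain ⟨g, rfl⟩ := exists_strongDual_ker_eq_of_isCoatom hY
  obtain ⟨w, hw, orthogonal⟩ := exists_norm_eq_one_forall_norm_le_of_isProj hP hY.1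
  have orthogonal_pow : ∀ y ∈ g.ker, ∀ t : ℝ,
      ‖y‖ ^ (2 * p) ≤ (1 + τ ^ 2) * ‖y + t • w‖ ^ (2 * p) := fun y hy t => calc
    ‖y‖ ^ (2 * p) ≤ (‖P‖ * ‖y + t • w‖) ^ (2 * p) := by
      gcongr
      exact orthogonal y hy t
    _ ≤ (1 + τ ^ 2) * ‖y + t • w‖ ^ (2 * p) := by
      rw [mul_pow]
      gcongr
  obtain ⟨a, b, hab, small⟩ :=
    hF.exists_pair_abs_apply_le hcard hα hsep hw.le hτ0 hτ1 orthogonal_pow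
  have const_nonneg : 0 ≤ coordinateConst (Fintype.card ι) p α := by
    unfold coordinateConst; positivity
  simpa [hw] using hF.norm_pow_le hβ hab (by positivity) small

theorem one_add_inv_sq_le_norm_pow_of_isProj (hF : IsEvenPowerNorming F p)
    (hcard : Fintype.card ι ≤ 2 * p) (hα : 0 < α) (hsep : IsTripleSeparated F α)
    (hβ : IsPairDominated F β) (hY : IsCoatom Y) {P : X →L[ℝ] X} (hP : LinearMap.IsProj Y P) :
    1 + ((Fintype.card ι + 2 * β ^ (2 * p)) * coordinateConst (Fintype.card ι) p α)⁻¹ ^ 2 ≤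
      ‖P‖ ^ (2 * p) := by
  have hp : p ≠ 0 := by have := Fintype.one_lt_card (α := ι); lia
  set A : ℝ := Fintype.card ι + 2 * β ^ (2 * p)
  set C := coordinateConst (Fintype.card ι) p α
  have hA : 1 < A := one_lt_card_add_two_mul_pow ι p β
  have hC : 1 ≤ C :=
    one_le_coordinateConst hp hα (hsep.le_one fun i x => hF.abs_apply_le_norm hp i x)
  by_contra! hlt
  have contra : 1 ≤ A * (C * (A * C)⁻¹) ^ (2 * p) :=
    one_le_mul_pow_of_isProj hF hcard hα hsep hβ hY hP (by positivity)
      (inv_le_one_of_one_le₀ (one_le_mul_of_one_le_of_one_le hA.le hC)) hlt.le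
  have cancel : C * (A * C)⁻¹ = A⁻¹ := by field_simp
  rw [cancel, inv_pow, ← div_eq_mul_inv, one_le_div (by positivity)] at contra
  exact contra.not_gt (lt_self_pow₀ hA (by lia))

end Hyperplane

theorem le_relProjConst_pow {X : Type*} [NormedAddCommGroup X] [NormedSpace ℝ X]
    [FiniteDimensional ℝ X] {Y : Submodule ℝ X} {r : ℝ} {k : ℕ}
    (h : ∀ P : X →L[ℝ] X, LinearMap.IsProj Y P → r ≤ ‖P‖ ^ k) : r ≤ relProjConst Y ^ k := by
  set norms := {s : ℝ | ∃ P : X →L[ℝ] X, (∀ x, P x ∈ Y) ∧ (∀ y ∈ Y, P y = y) ∧ s = ‖P‖}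
  have nonempty : norms.Nonempty := by
    obtain ⟨q, hq⟩ := Submodule.ClosedComplemented.of_finiteDimensional Y
    exact ⟨_, Y.subtypeL.comp q, fun x => (q x).2,
      fun y hy => congrArg Subtype.val (hq ⟨y, hy⟩), rfl⟩
  have bddBelow : BddBelow norms := ⟨0, by rintro _ ⟨P, -, -, rfl⟩; exact norm_nonneg P⟩
  have closed : IsClosed {s : ℝ | r ≤ s ^ k} := isClosed_le continuous_const (continuous_pow k)
  have norms_subset : norms ⊆ {s : ℝ | r ≤ s ^ k} := by
    rintro _ ⟨P, map_mem, map_id, rfl⟩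
    exact h P ⟨map_mem, map_id⟩
  exact closed.closure_subset_iff.2 norms_subset (csInf_mem_closure nonempty bddBelow)

theorem relProjConst_nonneg {X : Type*} [NormedAddCommGroup X] [NormedSpace ℝ X]
    (Y : Submodule ℝ X) : 0 ≤ relProjConst Y :=
  Real.sInf_nonneg <| by rintro _ ⟨P, -, -, rfl⟩; exact norm_nonneg P

theorem one_add_pow_le {x : ℝ} (h0 : 0 ≤ x) (h1 : x ≤ 1) (n : ℕ) :
    (1 + x) ^ n ≤ 1 + 2 ^ n * x := by
  induction n with
  | zero => simpa using h0
  | succ n ih =>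
    calc
      (1 + x) ^ (n + 1) = (1 + x) ^ n + (1 + x) ^ n * x := by ring
      _ ≤ (1 + 2 ^ n * x) + 2 ^ n * x := by gcongr; linarith
      _ = 1 + 2 ^ (n + 1) * x := by ring

theorem one_add_inv_pow_lt {A C D : ℝ} {p : ℕ} (hA : 1 < A) (hC : 0 < C) (hD : 1 ≤ D)
    (hCD : 4 ^ p * C ^ 2 ≤ D) : (1 + (A ^ 7 * D)⁻¹) ^ (2 * p) < 1 + (A * C)⁻¹ ^ 2 := by
  have hA7 : 1 ≤ A ^ 7 := one_le_pow₀ hA.le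
  have inv_le_one : (A ^ 7 * D)⁻¹ ≤ 1 :=
    inv_le_one_of_one_le₀ (one_le_mul_of_one_le_of_one_le hA7 hD)
  calc
    (1 + (A ^ 7 * D)⁻¹) ^ (2 * p) ≤ 1 + 2 ^ (2 * p) * (A ^ 7 * D)⁻¹ :=
      one_add_pow_le (by positivity) inv_le_one _
    _ ≤ 1 + 4 ^ p * (A ^ 7 * (4 ^ p * C ^ 2))⁻¹ := by
      rw [pow_mul]
      norm_num only
      gcongr
    _ = 1 + (A ^ 7 * C ^ 2)⁻¹ := by field_simp
    _ < 1 + (A ^ 2 * C ^ 2)⁻¹ := by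
      gcongr
      norm_num
    _ = 1 + (A * C)⁻¹ ^ 2 := by rw [inv_pow, mul_pow]

theorem two_pow_mul_coordinateConst_le {m p : ℕ} {α : ℝ} (hm : m ≠ 0) (hp : p ≠ 0) (hα0 : 0 < α)
    (hα1 : α ≤ 1) : 2 ^ p * coordinateConst m p α ≤ (48 * (m * p / α)) ^ (2 * p) := by
  have hm1 : (1 : ℝ) ≤ m := mod_cast Nat.one_le_iff_ne_zero.2 hm
  have hp1 : (1 : ℝ) ≤ p := mod_cast Nat.one_le_iff_ne_zero.2 hp
  have one_le_base : 1 ≤ 12 * p / α := (one_le_div hα0).2 (by linarith)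
  calc
    2 ^ p * ((12 * p / α) ^ (2 * p - 1) * (4 ^ p * (m + 1)))
    _ ≤ 2 ^ p * ((12 * p / α) ^ (2 * p) * (4 ^ p * (2 * m) ^ p)) := by
      gcongr
      · exact Nat.sub_le _ _
      · exact (by linarith : (m : ℝ) + 1 ≤ 2 * m).trans (le_self_pow₀ (by linarith) hp)
    _ = (12 * p / α) ^ (2 * p) * 4 ^ (2 * p) * m ^ p := by
      rw [mul_pow 2, pow_mul 4 2 p, (by norm_num : (4 : ℝ) ^ 2 = 2 * 2 * 4), mul_pow, mul_pow]
      ring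
    _ ≤ (12 * p / α) ^ (2 * p) * 4 ^ (2 * p) * m ^ (2 * p) := by
      gcongr
      lia
    _ = (48 * (m * p / α)) ^ (2 * p) := by
      rw [← mul_pow, ← mul_pow]
      ring

theorem four_pow_mul_coordinateConst_sq_le {n m p : ℕ} {α : ℝ} (hn : n ≠ 0) (hm : m ≠ 0)
    (hp : p ≠ 0) (hα0 : 0 < α) (hα1 : α ≤ 1) :
    4 ^ p * coordinateConst m p α ^ 2 ≤
      (α ^ (-6 : ℤ) * 2 ^ 14 * (n : ℝ) ^ 12 * (m : ℝ) ^ 11 * (p : ℝ) ^ 4) ^ (12 * p * m) := by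
  have hm1 : (1 : ℝ) ≤ m := mod_cast Nat.one_le_iff_ne_zero.2 hm
  have hp1 : (1 : ℝ) ≤ p := mod_cast Nat.one_le_iff_ne_zero.2 hp
  have hn1 : (1 : ℝ) ≤ n := mod_cast Nat.one_le_iff_ne_zero.2 hn
  have one_le : 1 ≤ 48 * (m * p / α) := by
    rw [← mul_div_assoc, one_le_div hα0]
    nlinarith
  have base_le : 48 * (m * p / α) ≤
      α ^ (-6 : ℤ) * 2 ^ 14 * (n : ℝ) ^ 12 * (m : ℝ) ^ 11 * (p : ℝ) ^ 4 := calc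
    48 * (m * p / α) = α⁻¹ * 48 * 1 * m * p := by ring
    _ ≤ α⁻¹ ^ 6 * 2 ^ 14 * n ^ 12 * m ^ 11 * p ^ 4 := by
      gcongr
      · exact le_self_pow₀ ((one_le_inv₀ hα0).2 hα1) (by simp)
      · norm_num
      · exact one_le_pow₀ hn1
      · exact le_self_pow₀ hm1 (by simp)
      · exact le_self_pow₀ hp1 (by simp)
    _ = _ := by
      rw [zpow_neg, inv_pow]
      norm_cast
  calc
    4 ^ p * coordinateConst m p α ^ 2 = (2 ^ p * coordinateConst m p α) ^ 2 := by
      rw [mul_pow, ← pow_mul, mul_comm p, pow_mul 2 2 p]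
      norm_num
    _ ≤ ((48 * (m * p / α)) ^ (2 * p)) ^ 2 := by
      gcongr
      · exact mul_nonneg (by positivity) (zero_le_one.trans (one_le_coordinateConst hp hα0 hα1))
      · exact two_pow_mul_coordinateConst_le hm hp hα0 hα1
    _ = (48 * (m * p / α)) ^ (4 * p) := by ring
    _ ≤ (48 * (m * p / α)) ^ (12 * p * m) :=
      pow_le_pow_right₀ one_le <|
        (by lia : 4 * p ≤ 12 * p).trans (Nat.le_mul_of_pos_right _ (Nat.pos_of_ne_zero hm))
    _ ≤ _ := by gcongr

theorem isCoatom_of_finrank_add_one_eq {K V : Type*} [DivisionRing K] [AddCommGroup V] [Module K V]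
    [FiniteDimensional K V] {Y : Submodule K V}
    (hY : Module.finrank K Y + 1 = Module.finrank K V) : IsCoatom Y := by
  refine ⟨?_, fun Z hYZ => Submodule.eq_top_of_finrank_eq ?_⟩
  · rintro rfl
    simp at hY
  · have := Submodule.finrank_lt_finrank_of_lt hYZ
    have := Z.finrank_le
    lia

theorem theorem1p1_general {X ι : Type*} [NormedAddCommGroup X] [NormedSpace ℝ X] [Fintype ι]
    [Nontrivial ι] {F : ι → StrongDual ℝ X} {p : ℕ} {α β : ℝ} {Y : Submodule ℝ X}
    (hF : IsEvenPowerNorming F p) (hcard : Fintype.card ι ≤ 2 * p) (hα : 0 < α)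
    (hsep : IsTripleSeparated F α) (hβ : IsPairDominated F β) (hY : IsCoatom Y) :
    relProjConst Y > 1 + ((Fintype.card ι : ℝ) + 2 * β ^ (2 * p)) ^ (-7 : ℤ) *
      (α ^ (-6 : ℤ) * 2 ^ 14 * (Module.finrank ℝ X : ℝ) ^ 12 * (Fintype.card ι : ℝ) ^ 11 *
        (p : ℝ) ^ 4) ^ (-(12 * (p : ℤ) * (Fintype.card ι : ℤ))) := by
  have hp : p ≠ 0 := by have := Fintype.one_lt_card (α := ι); lia
  have := hF.finiteDimensional hp
  have hn : Module.finrank ℝ X ≠ 0 := (Submodule.finrank_lt hY.1).ne_bot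
  have hα1 : α ≤ 1 := hsep.le_one fun i x => hF.abs_apply_le_norm hp i x
  have hC := one_le_coordinateConst (m := Fintype.card ι) hp hα hα1
  have hCD := four_pow_mul_coordinateConst_sq_le (m := Fintype.card ι) hn Fintype.card_ne_zero
    hp hα hα1
  have hD :=
    (one_le_mul_of_one_le_of_one_le (one_le_pow₀ (by norm_num)) (one_le_pow₀ hC)).trans hCD
  have lower := le_relProjConst_pow fun P hP =>
    one_add_inv_sq_le_norm_pow_of_isProj hF hcard hα hsep hβ hY (P := P) hP
  have upper := one_add_inv_pow_lt (one_lt_card_add_two_mul_pow ι p β)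
    (zero_lt_one.trans_le hC) hD hCD
  refine lt_of_pow_lt_pow_left₀ (2 * p) (relProjConst_nonneg Y)
    (lt_of_eq_of_lt ?_ (upper.trans_le lower))
  rw [mul_inv, zpow_neg, zpow_neg]
  norm_cast

namespace FunctionalSpace

variable {n m p : ℕ} {f : Fin m → Module.Dual ℝ (Fin n → ℝ)} {hp : 0 < p}
  {hf : ∀ x, (∀ i, f i x = 0) → x = 0}

theorem isEvenPowerNorming_functional : IsEvenPowerNorming (functional (f := f) hp hf) p := by
  intro x
  have exponent_cancel : 1 / (2 * p : ℝ) * (2 * p : ℕ) = 1 := by push_cast; field_simp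
  rw [norm_def, ← Real.rpow_natCast, ← Real.rpow_mul (sum_nonneg fun i _ => by positivity),
    exponent_cancel, Real.rpow_one]
  exact sum_congr rfl fun i _ => ((even_two_mul p).pow_abs _).symm

theorem isPairDominated_functional {β : ℝ}
    (hβ : ∀ j k : Fin m, j < k → ∀ x : Fin n → ℝ,
      max |f j x| |f k x| ≤ β * ⨆ i : {i : Fin m // i ≠ j ∧ i ≠ k}, |f i x|) :
    IsPairDominated (functional (f := f) hp hf) β := by
  intro j k hjk x
  rcases hjk.lt_or_gt with hlt | hlt
  · exact (le_max_left _ _).trans (hβ j k hlt x)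
  · exact ((le_max_right _ _).trans (hβ k j hlt x)).trans_eq <|
      congrArg (β * ·) ((Equiv.subtypeEquivRight fun _ => and_comm).iSup_congr fun _ => rfl)

theorem finrank_eq : Module.finrank ℝ (FunctionalSpace f p hp hf) = n :=
  Module.finrank_fin_fun ℝ

end FunctionalSpace

theorem theorem1p1 (n m p : ℕ) (hn : 4 ≤ n) (hm : n + 2 ≤ m) (hmp : (m : ℝ) / 2 ≤ p)
    (hp : 0 < p)
    (f : Fin m → Module.Dual ℝ (Fin n → ℝ)) (hf0 : ∀ i, f i ≠ 0)
    (hf : ∀ x, (∀ i, f i x = 0) → x = 0)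
    (α : ℝ) (hα0 : 0 < α) (hα1 : α ≤ 1 / 2)
    (hα : ∀ j k l : Fin m, j < k → k < l → ∀ i : Fin m, i ≠ j → i ≠ k → i ≠ l →
      α ≤ Metric.infDist (FunctionalSpace.functional hp hf i)
        (Submodule.span ℝ {FunctionalSpace.functional hp hf j, FunctionalSpace.functional hp hf k,
          FunctionalSpace.functional hp hf l} :
            Set (StrongDual ℝ (FunctionalSpace f p hp hf))))
    (β : ℝ) (hβ0 : 0 < β)
    (hβ : ∀ j k : Fin m, j < k → ∀ x : Fin n → ℝ,
      max |f j x| |f k x| ≤ β * ⨆ i : {i : Fin m // i ≠ j ∧ i ≠ k}, |f i x|)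
    (Y : Submodule ℝ (FunctionalSpace f p hp hf)) (hY : Module.finrank ℝ Y = n - 1) :
    relProjConst Y > 1 + ((m : ℝ) + 2 * β ^ (2 * p)) ^ (-7 : ℤ) *
      (α ^ (-6 : ℤ) * 2 ^ 14 * (n : ℝ) ^ 12 * (m : ℝ) ^ 11 * (p : ℝ) ^ 4) ^
        (-(12 * (p : ℤ) * (m : ℤ))) := by
  have : Nontrivial (Fin m) := Fin.nontrivial_iff_two_le.2 (by lia)
  have hcard : m ≤ 2 * p := mod_cast (by linarith : (m : ℝ) ≤ 2 * p)
  have hY' : IsCoatom Y := isCoatom_of_finrank_add_one_eq (by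
    rw [hY, FunctionalSpace.finrank_eq]; lia)
  simpa only [Fintype.card_fin, FunctionalSpace.finrank_eq] using
    theorem1p1_general FunctionalSpace.isEvenPowerNorming_functional
      (by rwa [Fintype.card_fin]) hα0
      (.of_lt (by rw [Fintype.card_fin]; lia) hα)
      (FunctionalSpace.isPairDominated_functional hβ) hY'
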